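/- Let $u,\overline\gamma,\lambda>0$ be real and let $\mu\ge 1$ be an integer. Let the parameters $h,H$ of the $\eta$-$\mu$ fading model be given either by Format 1, $h=\frac{2+\eta^{-1}+\eta}{4}$, $H=\frac{\eta^{-1}-\eta}{4}$ with $0<\eta<\infty$, or by Format 2, $h=\frac{1}{1-\eta^2}$, $H=\frac{\eta}{1-\eta^2}$ with $-1<\eta<1$, and assume $H\ne 0$ (that is, $\eta\neq 1$ in Format 1 and $\eta\ne 0$ in Format 2). Let $$p_\gamma(\gamma)=\frac{2\sqrt\pi\,\mu^{\mu+\frac12}h^\mu}{\Gamma(\mu)H^{\mu-\frac12}}\,\frac{\gamma^{\mu-\frac12}}{\overline\gamma^{\,\mu+\frac12}}\,e^{-2\mu h\gamma/\overline\gamma}\,I_{\mu-\frac12}\!\left(\frac{2\mu H\gamma}{\overline\gamma}\right),\qquad \gamma>0,$$ be the $\eta$-$\mu$ SNR density, where $I_\nu$ is the modified Bessel function of the first kind (for $H<0$ both $H^{\mu-\frac12}$ and $I_{\mu-\frac12}$ are taken on the principal branch, and the quotient is real). Let $$Q_u(a,b)=\int_b^\infty \frac{x^u}{a^{u-1}}\,e^{-(x^2+a^2)/2}\,I_{u-1}(ax)\,dx$$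 be the generalized Marcum $Q$-function. Then the average detection probability $\overline P_d=\int_0^\infty Q_u(\sqrt{2\gamma},\sqrt\lambda)\,p_\gamma(\gamma)\,d\gamma$ exists (the integrand is integrable) and $$\begin{aligned}\overline P_d={}&\sum_{l=0}^{\mu-1}\frac{(\mu)_l\,h^\mu\,\mathcal G(u,\frac\lambda2)}{l!\,2^{\mu+l}H^{\mu+l}}\left\{\frac{(-1)^l}{(h-H)^{\mu-l}}+\frac{(-1)^\mu}{(h+H)^{\mu-l}}\right\}\\&+\sum_{l=0}^{\mu-1}\sum_{i=0}^{\mu-l-1}\frac{h^\mu\mu^i\lambda^u(\mu)_l\,\overline\gamma\,e^{-\lambda/2}}{\Gamma(u+1)\,l!\,2^{\mu+u+l-i}H^{\mu+l}}\left\{\frac{(-1)^l\,{}_1F_1\!\left(1+i,1+u,\frac{\lambda\overline\gamma}{2\overline\gamma+4\mu(h-H)}\right)}{(h-H)^{\mu-l-i}(\overline\gamma+2(h-H)\mu)^{i+1}}+\frac{(-1)^\mu\,{}_1F_1\!\left(1+i,1+u,\frac{\lambda\overline\gamma}{2\overline\gamma+4\mu(h+H)}\right)}{(h+H)^{\mu-l-i}(\overline\gamma+2(h+H)\mu)^{i+1}}\right\},\end{aligned}$$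 where $(\mu)_l=\mu(\mu+1)\cdots(\mu+l-1)$ is the Pochhammer symbol, $\mathcal G(a,x)=\Gamma(a,x)/\Gamma(a)$ is the regularized upper incomplete gamma function, and ${}_1F_1$ is the Kummer confluent hypergeometric function. -/

import Mathlib

open scoped Nat

noncomputable section

/-- The upper incomplete gamma function `Γ(a, x) = ∫_x^∞ t^(a-1) e^(-t) dt`. -/
def upperGamma (a x : ℝ) : ℝ :=
  ∫ t in Set.Ioi x, t ^ (a - 1) * Real.exp (-t)

/-- The regularized upper incomplete gamma function `𝒢(a, x) = Γ(a, x) / Γ(a)`. -/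
def regUpperGamma (a x : ℝ) : ℝ :=
  upperGamma a x / Real.Gamma a

/-- The Pochhammer symbol (rising factorial) `(x)_n = x (x + 1) ⋯ (x + n - 1)`. -/
def poch (x : ℝ) (n : ℕ) : ℝ :=
  (ascPochhammer ℝ n).eval x

/-- The Kummer confluent hypergeometric function
`₁F₁(a, b, z) = ∑ (a)_n / (b)_n * z^n / n!`. -/
def kummer1F1 (a b z : ℝ) : ℝ :=
  ∑' n : ℕ, poch a n / poch b n * z ^ n / (n ! : ℝ)

/-- The entire factor of the modified Bessel function,
`∑ (x/2)^(2k) / (k! Γ(ν + k + 1))`, so that `I_ν(x) = (x/2)^ν * besselISeries ν x`. -/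
def besselISeries (ν x : ℝ) : ℝ :=
  ∑' k : ℕ, (x / 2) ^ (2 * k) / ((k ! : ℝ) * Real.Gamma (ν + k + 1))

/-- The modified Bessel function of the first kind `I_ν(x)` for real `x ≥ 0`. -/
def besselI (ν x : ℝ) : ℝ :=
  (x / 2) ^ ν * besselISeries ν x

/-- The modified Bessel function of the first kind `I_ν(x)` on the whole real line, with the
principal branch of the power; it is complex valued for `x < 0`. -/
def besselIC (ν x : ℝ) : ℂ :=
  (((x / 2 : ℝ) : ℂ)) ^ (ν : ℂ) * (besselISeries ν x : ℂ)

/-- The generalized Marcum function of real order `m > 0` for `a, b ≥ 0`,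
`Q_m(a, b) = ∫_b^∞ x^m / a^(m-1) e^(-(x^2+a^2)/2) I_{m-1}(a x) dx`,
with its limit value `Γ(m, b^2/2) / Γ(m)` at `a = 0`. -/
def marcumQ (m a b : ℝ) : ℝ :=
  if a = 0 then regUpperGamma m (b ^ 2 / 2)
  else ∫ x in Set.Ioi b,
    x ^ m / a ^ (m - 1) * Real.exp (-(x ^ 2 + a ^ 2) / 2) * besselI (m - 1) (a * x)

/-- The two formats of the η-μ fading model. -/
inductive EtaMuFormat where
  | format1
  | format2

/-- The range of the parameter `η` in each format. -/
def EtaMuFormat.Admissible : EtaMuFormat → ℝ → Prop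
  | .format1, η => 0 < η
  | .format2, η => -1 < η ∧ η < 1

/-- The parameter `h` of the η-μ model. -/
def EtaMuFormat.h : EtaMuFormat → ℝ → ℝ
  | .format1, η => (2 + η⁻¹ + η) / 4
  | .format2, η => 1 / (1 - η ^ 2)

/-- The parameter `H` of the η-μ model. -/
def EtaMuFormat.H : EtaMuFormat → ℝ → ℝ
  | .format1, η => (η⁻¹ - η) / 4
  | .format2, η => η / (1 - η ^ 2)

/-- The closed expression for the η-μ SNR density, for `H ≠ 0` of either sign. The powers
`H^(μ - 1/2)` and `I_{μ-1/2}(2 μ H γ / γbar)` are taken on the principal branch. -/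
def etaMuPDFC (h H μ γbar γ : ℝ) : ℂ :=
  ((2 * Real.sqrt Real.pi * μ ^ (μ + 1 / 2) * h ^ μ : ℝ) : ℂ)
      / ((Real.Gamma μ : ℂ) * (H : ℂ) ^ ((μ - 1 / 2 : ℝ) : ℂ))
    * ((γ ^ (μ - 1 / 2) / γbar ^ (μ + 1 / 2) : ℝ) : ℂ)
    * ((Real.exp (-2 * μ * h * γ / γbar) : ℝ) : ℂ)
    * besselIC (μ - 1 / 2) (2 * μ * H * γ / γbar)

/-- The η-μ SNR density as a real function; `etaMuPDFC` is real valued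
(see `etaMuPDFC_eq`), so nothing is lost in taking the real part. -/
def etaMuPDF (h H μ γbar γ : ℝ) : ℝ :=
  (etaMuPDFC h H μ γbar γ).re

theorem besselISeries_abs (ν x : ℝ) : besselISeries ν |x| = besselISeries ν x := by
  unfold besselISeries
  congr 1
  funext k
  rw [pow_mul, pow_mul, div_pow, div_pow x, sq_abs]

/-- The density is real and even in `H`: it equals the usual real expression at `|H|`. -/
theorem etaMuPDFC_eq {h H μ γbar γ : ℝ} (hH : H ≠ 0) (hμ : 0 < μ) (hγbar : 0 < γbar)
    (hγ : 0 < γ) :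
    etaMuPDFC h H μ γbar γ =
      ((2 * Real.sqrt Real.pi * μ ^ (μ + 1 / 2) * h ^ μ
          / (Real.Gamma μ * |H| ^ (μ - 1 / 2))
        * (γ ^ (μ - 1 / 2) / γbar ^ (μ + 1 / 2))
        * Real.exp (-2 * μ * h * γ / γbar)
        * besselI (μ - 1 / 2) (2 * μ * |H| * γ / γbar) : ℝ) : ℂ) := by
  have hr : 0 < μ * γ / γbar := by positivity
  have e1 : 2 * μ * H * γ / γbar / 2 = μ * γ / γbar * H := by ring
  have e2 : 2 * μ * |H| * γ / γbar / 2 = μ * γ / γbar * |H| := by ring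
  have e3 : 2 * μ * |H| * γ / γbar = |2 * μ * H * γ / γbar| := by
    rw [abs_div, abs_mul, abs_mul, abs_of_pos hγbar, abs_of_pos hγ,
      abs_of_pos (show (0 : ℝ) < 2 * μ by positivity)]
  have hS : besselISeries (μ - 1 / 2) (2 * μ * |H| * γ / γbar)
      = besselISeries (μ - 1 / 2) (2 * μ * H * γ / γbar) := by
    rw [e3, besselISeries_abs]
  unfold etaMuPDFC besselIC besselI
  rw [hS, e1, e2]
  generalize besselISeries (μ - 1 / 2) (2 * μ * H * γ / γbar) = S
  generalize Real.exp (-2 * μ * h * γ / γbar) = E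
  generalize γ ^ (μ - 1 / 2) / γbar ^ (μ + 1 / 2) = G
  generalize 2 * Real.sqrt Real.pi * μ ^ (μ + 1 / 2) * h ^ μ = A
  generalize μ - 1 / 2 = ν
  generalize μ * γ / γbar = r at hr
  have hc : (H : ℂ) ^ (ν : ℂ) ≠ 0 := by
    rw [Ne, Complex.cpow_eq_zero_iff]
    simp [hH]
  have hc' : (((|H| ^ ν : ℝ)) : ℂ) ≠ 0 := by
    have : (0 : ℝ) < |H| ^ ν := Real.rpow_pos_of_pos (abs_pos.mpr hH) _
    exact_mod_cast this.ne'
  have hG : (Real.Gamma μ : ℂ) ≠ 0 := by exact_mod_cast (Real.Gamma_pos_of_pos hμ).ne'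
  have hp : (((r * H : ℝ)) : ℂ) ^ (ν : ℂ) = ((r ^ ν : ℝ) : ℂ) * (H : ℂ) ^ (ν : ℂ) := by
    have hr0 : (r : ℂ) ≠ 0 := by exact_mod_cast hr.ne'
    have hH0 : (H : ℂ) ≠ 0 := by exact_mod_cast hH
    rw [Complex.ofReal_mul, Complex.ofReal_cpow hr.le,
      Complex.cpow_def_of_ne_zero (mul_ne_zero hr0 hH0), Complex.cpow_def_of_ne_zero hr0,
      Complex.cpow_def_of_ne_zero hH0, Complex.log_ofReal_mul hr hH0, Complex.ofReal_log hr.le,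
      ← Complex.exp_add, add_mul]
  rw [hp, Real.mul_rpow hr.le (abs_nonneg H)]
  simp only [Complex.ofReal_mul, Complex.ofReal_div]
  field_simp

/-- The detection probability of the energy detector at SNR `γ`,
`P_d = Q_u(√(2γ), √λ)`. -/
def detectionProb (u lam γ : ℝ) : ℝ :=
  marcumQ u (Real.sqrt (2 * γ)) (Real.sqrt lam)

/-- The average detection probability over η-μ fading,
`∫_0^∞ Q_u(√(2γ), √λ) p_γ(γ) dγ`. -/
def avgDetectionProb (h H μ γbar u lam : ℝ) : ℝ :=
  ∫ γ in Set.Ioi (0 : ℝ), detectionProb u lam γ * etaMuPDF h H μ γbar γ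

end

/-! For integer `μ` the Bessel function in the density has half-integer order, so it is elementary:
exponentials `e^x` and `e^(-x)` times polynomials in `1/x` (`besselISeries_nat_add_half`). The
density is therefore a finite combination of gamma-type functions `γ^(μ-1-l) e^(-pγ)` with rates `p
= 2μ(h ∓ H)/γbar` (`etaMuPDF_eq_sum`), and both rates are positive.

It remains to average the detection probability over one such function. Expanding the Bessel
function inside the Marcum integral shows that `Q_u(√(2γ), √λ)` is a Poisson mixture, with mean `γ`,
of the numbers `𝒢(u+n, λ/2)` (`hasSum_detectionProb`). Integration against `γ^m e^(-pγ)` replaces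
the Poisson weights by negative binomial ones. Summation by parts, applied `m+1` times, lowers the
negative binomial order to zero. It leaves `𝒢(u, λ/2)` plus sums over the increments of `𝒢(u+n,
λ/2)` in `n`. These increments are explicit, and the sums are Kummer series
(`integral_detectionProb_mul_pow_mul_exp`).

All interchanges of sum and integral involve nonnegative terms. -/

open MeasureTheory

noncomputable section

/-! ### Modified Bessel functions of half-integer order -/

/-- The polynomial `∑ (n+k)! / (k! (n-k)!) t^k`, a rescaled Bessel polynomial. -/
def besselPoly (n : ℕ) (t : ℝ) : ℝ :=
  ∑ k ∈ Finset.range (n + 1), ((n + k).choose (2 * k) : ℝ) * ((2 * k)! / k ! : ℝ) * t ^ k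

theorem besselPoly_eq_sum_range {n N : ℕ} (h : n + 1 ≤ N) (t : ℝ) :
    besselPoly n t =
      ∑ k ∈ Finset.range N, ((n + k).choose (2 * k) : ℝ) * ((2 * k)! / k ! : ℝ) * t ^ k := by
  unfold besselPoly
  refine Finset.sum_subset (Finset.range_mono h) ?_
  intro k _ hk
  rw [Finset.mem_range, not_lt] at hk
  rw [Nat.choose_eq_zero_of_lt (by omega)]
  simp

/-- This is the coefficient form of the three-term recurrence for `besselPoly`, with the denominator
`2k+1` cleared. Pascal's rule, used twice, reduces it to two absorption identities for `N = n+k+1`,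
whose factors add up to `(N+1) + (N-2k) = 2n+3`. -/
theorem choose_besselPoly_recurrence (n k : ℕ) :
    (2 * k + 1) * (n + 2 + (k + 1)).choose (2 * (k + 1))
      = (2 * k + 1) * (n + (k + 1)).choose (2 * (k + 1)) + (2 * n + 3) * (n + 1 + k).choose (2 * k) := by
  have e1 : (n + 2 + (k + 1)).choose (2 * (k + 1))
      = (n + k + 2).choose (2 * k + 1) + (n + k + 2).choose (2 * k + 2) := by
    rw [show n + 2 + (k + 1) = (n + k + 2) + 1 by ring, show 2 * (k + 1) = (2 * k + 1) + 1 by ring,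
      Nat.choose_succ_succ]
  have e2 : (n + k + 2).choose (2 * k + 2)
      = (n + k + 1).choose (2 * k + 1) + (n + k + 1).choose (2 * k + 2) :=
    Nat.choose_succ_succ _ _
  have e3 := Nat.add_one_mul_choose_eq (n + k + 1) (2 * k)
  have e4 := Nat.choose_succ_right_eq (n + k + 1) (2 * k)
  rw [e1, e2, show n + (k + 1) = n + k + 1 by ring, show 2 * (k + 1) = 2 * k + 2 by ring,
    show n + 1 + k = n + k + 1 by ring]
  -- The split keeps the natural subtraction `n+k+1-2k` honest; in the second case the binomials
  -- with lower index `2k` or `2k+1` vanish.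
  rcases le_or_gt (2 * k) (n + k + 1) with hk | hk
  · obtain ⟨d, hd⟩ := Nat.exists_eq_add_of_le hk
    rw [show n + k + 1 - 2 * k = d by omega] at e4
    have : (2 * n + 3 : ℕ) = (n + k + 2) + d := by omega
    rw [this]
    linear_combination -e3 + e4
  · rw [Nat.choose_eq_zero_of_lt hk, Nat.choose_eq_zero_of_lt (by omega : n + k + 2 < 2 * k + 1),
      Nat.choose_eq_zero_of_lt (by omega : n + k + 1 < 2 * k + 1)]
    simp

/-- At `t = ∓1/(2x)` this matches `I_(ν+1) = I_(ν-1) - (2ν/x) I_ν` with `ν = n + 3/2`, which drives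
the induction below. -/
theorem besselPoly_succ_succ (n : ℕ) (t : ℝ) :
    besselPoly (n + 2) t = besselPoly n t + 2 * (2 * n + 3) * t * besselPoly (n + 1) t := by
  rw [besselPoly_eq_sum_range (le_refl (n + 2 + 1)), 
    besselPoly_eq_sum_range (Nat.le_add_right (n + 1) 2),
    besselPoly_eq_sum_range (le_refl (n + 1 + 1)), Finset.sum_range_succ' _ (n + 2),
    Finset.sum_range_succ' _ (n + 2), Finset.mul_sum]
  refine Eq.trans ?_ (add_right_comm _ _ _)
  rw [← Finset.sum_add_distrib]
  congr 1
  · refine Finset.sum_congr rfl fun k _ => ?_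
    have h := congrArg (Nat.cast : ℕ → ℝ) (choose_besselPoly_recurrence n k)
    push_cast at h
    have hf : (((2 * (k + 1))! : ℕ) : ℝ) / ((k + 1)! : ℕ)
        = 2 * (2 * k + 1) * ((2 * k)! / k !) := by
      rw [show 2 * (k + 1) = 2 * k + 1 + 1 by ring, Nat.factorial_succ (2 * k + 1),
        Nat.factorial_succ (2 * k), Nat.factorial_succ k]
      push_cast
      have : (k ! : ℝ) ≠ 0 := by positivity
      field_simp
      ring
    rw [hf]
    linear_combination 2 * ((2 * k)! / k ! : ℝ) * t ^ (k + 1) * h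
  · simp

theorem hasSum_of_eq {f g : ℕ → ℝ} {a b : ℝ} (h : HasSum f a) (hfg : ∀ k, g k = f k)
    (hab : b = a) : HasSum g b := by
  rwa [hab, funext hfg]

/-- The Bessel recurrence for the entire factor. Termwise, `1/Γ(ν+k) - ν/Γ(ν+k+1) = k/Γ(ν+k+1)`, so
the constant term cancels and the series shifts by one. The `HasSum` form carries summability
through the induction. -/
theorem hasSum_besselISeries_succ {ν x a b : ℝ} (hν : 0 < ν) (hx : x ≠ 0)
    (ha : HasSum (fun k : ℕ => (x / 2) ^ (2 * k) / ((k ! : ℝ) * Real.Gamma (ν - 1 + k + 1))) a)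
    (hb : HasSum (fun k : ℕ => (x / 2) ^ (2 * k) / ((k ! : ℝ) * Real.Gamma (ν + k + 1))) b) :
    HasSum (fun k : ℕ => (x / 2) ^ (2 * k) / ((k ! : ℝ) * Real.Gamma (ν + 1 + k + 1)))
      ((a - ν * b) / (x / 2) ^ 2) := by
  have h := (ha.sub (hb.mul_left ν)).div_const ((x / 2) ^ 2)
  rw [← hasSum_nat_add_iff' 1] at h
  refine hasSum_of_eq h (fun k => ?_) ?_
  · have e1 : ν - 1 + ((k + 1 : ℕ) : ℝ) + 1 = ν + k + 1 := by push_cast; ring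
    have e2 : ν + ((k + 1 : ℕ) : ℝ) + 1 = (ν + k + 1) + 1 := by push_cast; ring
    have e3 : ν + 1 + k + 1 = (ν + k + 1) + 1 := by ring
    have h0 : 0 < ν + k + 1 := by positivity
    rw [e1, e2, e3, Real.Gamma_add_one h0.ne', Nat.factorial_succ]
    have hG := (Real.Gamma_pos_of_pos h0).ne'
    have hf : (k ! : ℝ) ≠ 0 := by positivity
    push_cast
    field_simp
    ring
  · have hG := (Real.Gamma_pos_of_pos hν).ne'
    simp [Real.Gamma_add_one hν.ne']
    field_simp
    simp

/-- Legendre's duplication formula turns `k! Γ(k+1/2)` into `(2k)! √π / 2^(2k)`, which gives the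
cosh series. The unreduced `1/2 - 1` fits the hypothesis of `hasSum_besselISeries_succ`. -/
theorem hasSum_besselISeries_neg_half (x : ℝ) :
    HasSum (fun k : ℕ => (x / 2) ^ (2 * k) / ((k ! : ℝ) * Real.Gamma (1 / 2 - 1 + k + 1)))
      (Real.cosh x / √Real.pi) := by
  refine hasSum_of_eq ((Real.hasSum_cosh x).div_const √Real.pi) (fun k => ?_) rfl
  have h := Real.Gamma_mul_Gamma_add_half ((k : ℝ) + 1 / 2)
  rw [show (k : ℝ) + 1 / 2 + 1 / 2 = k + 1 by ring, Real.Gamma_nat_eq_factorial,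
    show 2 * ((k : ℝ) + 1 / 2) = (2 * k : ℕ) + 1 by push_cast; ring, Real.Gamma_nat_eq_factorial,
    show 1 - (((2 * k : ℕ) : ℝ) + 1) = -((2 * k : ℕ) : ℝ) by ring, Real.rpow_neg (by norm_num),
    Real.rpow_natCast] at h
  rw [show (1 : ℝ) / 2 - 1 + k + 1 = k + 1 / 2 by ring, mul_comm (k ! : ℝ), h, div_pow]
  have : √Real.pi ≠ 0 := by positivity
  field_simp

theorem hasSum_besselISeries_half {x : ℝ} (hx : x ≠ 0) :
    HasSum (fun k : ℕ => (x / 2) ^ (2 * k) / ((k ! : ℝ) * Real.Gamma (1 / 2 + k + 1)))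
      (2 * Real.sinh x / (x * √Real.pi)) := by
  refine hasSum_of_eq (((Real.hasSum_sinh x).mul_left 2).div_const (x * √Real.pi)) (fun k => ?_) rfl
  have h := Real.Gamma_mul_Gamma_add_half ((k : ℝ) + 1)
  rw [Real.Gamma_nat_eq_factorial,
    show 2 * ((k : ℝ) + 1) = (2 * k + 1 : ℕ) + 1 by push_cast; ring, Real.Gamma_nat_eq_factorial,
    show 1 - (((2 * k + 1 : ℕ) : ℝ) + 1) = -((2 * k + 1 : ℕ) : ℝ) by ring,
    Real.rpow_neg (by norm_num), Real.rpow_natCast] at h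
  rw [show (1 : ℝ) / 2 + k + 1 = k + 1 + 1 / 2 by ring, h, div_pow]
  have : √Real.pi ≠ 0 := by positivity
  field_simp
  ring

theorem hasSum_besselISeries_nat_add_half {x : ℝ} (hx : x ≠ 0) (n : ℕ) :
    HasSum (fun k : ℕ => (x / 2) ^ (2 * k) / ((k ! : ℝ) * Real.Gamma ((n : ℝ) + 1 / 2 + k + 1)))
      (2 ^ n / (√Real.pi * x ^ (n + 1)) * (Real.exp x * besselPoly n (-(1 / (2 * x)))
        + (-1) ^ (n + 1) * Real.exp (-x) * besselPoly n (1 / (2 * x)))) := by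
  have hpi : √Real.pi ≠ 0 := by positivity
  induction n using Nat.twoStepInduction with
  | zero =>
    convert hasSum_besselISeries_half hx using 1
    · simp
    · simp [besselPoly, Real.sinh_eq]
      field_simp
      ring
  | one =>
    convert hasSum_besselISeries_succ (by norm_num) hx (hasSum_besselISeries_neg_half x)
      (hasSum_besselISeries_half hx) using 1
    · funext k
      norm_num [add_comm]
    · simp [besselPoly, Real.sinh_eq, Real.cosh_eq, Finset.sum_range_succ]
      field_simp
      ring
  | more n ih0 ih1 =>
    convert hasSum_besselISeries_succ (ν := (n : ℝ) + 1 + 1 / 2) (by positivity) hx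
      (by convert ih0 using 6; ring) (by convert ih1 using 6; push_cast; ring)
      using 1
    · funext k
      push_cast
      ring_nf
    · rw [besselPoly_succ_succ, besselPoly_succ_succ]
      field_simp
      ring

theorem besselISeries_nat_add_half {x : ℝ} (hx : x ≠ 0) (n : ℕ) :
    besselISeries ((n : ℝ) + 1 / 2) x =
      2 ^ n / (√Real.pi * x ^ (n + 1)) * (Real.exp x * besselPoly n (-(1 / (2 * x)))
        + (-1) ^ (n + 1) * Real.exp (-x) * besselPoly n (1 / (2 * x))) :=
  (hasSum_besselISeries_nat_add_half hx n).tsum_eq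

/-! ### The incomplete gamma function -/

theorem integrableOn_upperGamma {a x : ℝ} (ha : 0 < a) (hx : 0 ≤ x) :
    IntegrableOn (fun t : ℝ => t ^ (a - 1) * Real.exp (-t)) (Set.Ioi x) := by
  refine IntegrableOn.mono_set ?_ (Set.Ioi_subset_Ioi hx)
  simpa only [mul_comm] using Real.GammaIntegral_convergent ha

theorem upperGamma_pos {a x : ℝ} (ha : 0 < a) (hx : 0 ≤ x) : 0 < upperGamma a x := by
  refine (setIntegral_pos_iff_support_of_nonneg_ae ?_ (integrableOn_upperGamma ha hx)).2 ?_
  · filter_upwards [self_mem_ae_restrict measurableSet_Ioi] with t ht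
    exact mul_nonneg (Real.rpow_nonneg (hx.trans (le_of_lt ht)) _) (Real.exp_pos _).le
  · rw [Set.inter_eq_self_of_subset_right]
    · simp
    · intro t ht
      have ht0 : 0 < t := lt_of_le_of_lt hx ht
      exact (mul_pos (Real.rpow_pos_of_pos ht0 _) (Real.exp_pos _)).ne'

theorem upperGamma_le_Gamma {a x : ℝ} (ha : 0 < a) (hx : 0 ≤ x) :
    upperGamma a x ≤ Real.Gamma a := by
  rw [Real.Gamma_eq_integral ha]
  simp only [mul_comm (Real.exp _)]
  refine setIntegral_mono_set (integrableOn_upperGamma ha le_rfl) ?_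
    (Set.Ioi_subset_Ioi hx).eventuallyLE
  filter_upwards [self_mem_ae_restrict measurableSet_Ioi] with t ht
  exact mul_nonneg (Real.rpow_nonneg (le_of_lt ht) _) (Real.exp_pos _).le

/-- Integration by parts: the derivative of `t^a e^(-t)` is integrated over `(x, ∞)`. -/
theorem upperGamma_add_one {a x : ℝ} (ha : 0 < a) (hx : 0 < x) :
    upperGamma (a + 1) x = a * upperGamma a x + x ^ a * Real.exp (-x) := by
  have h1 := integrableOn_upperGamma (a := a + 1) (by positivity) hx.le
  have h2 := (integrableOn_upperGamma ha hx.le).const_mul a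
  have key := integral_Ioi_of_hasDerivAt_of_tendsto (a := x) (m := 0)
    (f := fun t : ℝ => t ^ a * Real.exp (-t))
    (f' := fun t : ℝ => a * (t ^ (a - 1) * Real.exp (-t)) - t ^ (a + 1 - 1) * Real.exp (-t))
    ?_ ?_ (h2.sub h1) ?_
  · rw [integral_sub h2 h1, integral_const_mul] at key
    unfold upperGamma
    linarith
  · exact ((Real.continuousAt_rpow_const x a (Or.inl hx.ne')).mul
      (by fun_prop)).continuousWithinAt
  · intro t ht
    have ht0 : t ≠ 0 := (lt_trans hx ht).ne'
    refine ((Real.hasDerivAt_rpow_const (p := a) (Or.inl ht0)).mul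
      (hasDerivAt_neg t).exp).congr_deriv ?_
    rw [add_sub_cancel_right]
    ring
  · simpa using tendsto_rpow_mul_exp_neg_mul_atTop_nhds_zero a 1 one_pos

theorem regUpperGamma_pos {a x : ℝ} (ha : 0 < a) (hx : 0 ≤ x) : 0 < regUpperGamma a x :=
  div_pos (upperGamma_pos ha hx) (Real.Gamma_pos_of_pos ha)

theorem regUpperGamma_le_one {a x : ℝ} (ha : 0 < a) (hx : 0 ≤ x) : regUpperGamma a x ≤ 1 :=
  div_le_one_of_le₀ (upperGamma_le_Gamma ha hx) (Real.Gamma_pos_of_pos ha).le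

theorem regUpperGamma_add_one {a x : ℝ} (ha : 0 < a) (hx : 0 < x) :
    regUpperGamma (a + 1) x
      = regUpperGamma a x + x ^ a * Real.exp (-x) / Real.Gamma (a + 1) := by
  have := (Real.Gamma_pos_of_pos ha).ne'
  unfold regUpperGamma
  rw [upperGamma_add_one ha hx, Real.Gamma_add_one ha.ne']
  field_simp

/-! ### The Marcum function as a Poisson mixture -/

theorem image_sq_div_two_Ioi {b : ℝ} (hb : 0 ≤ b) :
    (fun x : ℝ => x ^ 2 / 2) '' Set.Ioi b = Set.Ioi (b ^ 2 / 2) := by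
  ext y
  simp only [Set.mem_image, Set.mem_Ioi]
  constructor
  · rintro ⟨x, hx, rfl⟩
    nlinarith
  · intro hy
    refine ⟨√(2 * y), Real.lt_sqrt_of_sq_lt (by linarith), ?_⟩
    rw [Real.sq_sqrt (by nlinarith [sq_nonneg b])]
    ring

theorem integrableOn_and_integral_sq_substitution {b : ℝ} (hb : 0 ≤ b) {g : ℝ → ℝ}
    (hg : IntegrableOn g (Set.Ioi (b ^ 2 / 2))) :
    IntegrableOn (fun x => x * g (x ^ 2 / 2)) (Set.Ioi b) ∧
      ∫ x in Set.Ioi b, x * g (x ^ 2 / 2) = ∫ t in Set.Ioi (b ^ 2 / 2), g t := by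
  have hd : ∀ x ∈ Set.Ioi b, HasDerivWithinAt (fun x : ℝ => x ^ 2 / 2) x (Set.Ioi b) x := by
    intro x _
    have := ((hasDerivAt_pow 2 x).div_const 2).hasDerivWithinAt (s := Set.Ioi b)
    simpa using this
  have hi : Set.InjOn (fun x : ℝ => x ^ 2 / 2) (Set.Ioi b) := by
    intro x hx y hy hxy
    have hx0 : 0 < x := lt_of_le_of_lt hb hx
    have hy0 : 0 < y := lt_of_le_of_lt hb hy
    have : x ^ 2 = y ^ 2 := by simpa using hxy
    exact (pow_left_inj₀ hx0.le hy0.le two_ne_zero).1 this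
  have habs : ∀ x ∈ Set.Ioi b, |x| • g (x ^ 2 / 2) = x * g (x ^ 2 / 2) := fun x hx => by
    rw [abs_of_pos (lt_of_le_of_lt hb hx), smul_eq_mul]
  rw [← image_sq_div_two_Ioi hb] at hg ⊢
  refine ⟨?_, ?_⟩
  · exact ((integrableOn_image_iff_integrableOn_abs_deriv_smul measurableSet_Ioi hd hi g).1
      hg).congr_fun habs measurableSet_Ioi
  · rw [integral_image_eq_integral_abs_deriv_smul measurableSet_Ioi hd hi g]
    exact (setIntegral_congr_fun measurableSet_Ioi habs).symm

theorem marcumQ_integrand_eq_tsum {m a x : ℝ} (ha : 0 < a) (hx : 0 < x) :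
    x ^ m / a ^ (m - 1) * Real.exp (-(x ^ 2 + a ^ 2) / 2) * besselI (m - 1) (a * x)
      = ∑' k : ℕ, Real.exp (-(a ^ 2 / 2)) * (a ^ 2 / 2) ^ k / ((k ! : ℝ) * Real.Gamma (m + k))
          * (x * ((x ^ 2 / 2) ^ (m + k - 1) * Real.exp (-(x ^ 2 / 2)))) := by
  unfold besselI besselISeries
  rw [← mul_assoc, ← tsum_mul_left]
  congr 1
  funext k
  have hx2 : 0 < x ^ 2 / 2 := by positivity
  have e1 : (x ^ 2 / 2) ^ (m + k - 1) = (x ^ 2 / 2) ^ (m - 1) * (x ^ 2 / 2) ^ k := by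
    rw [← Real.rpow_add_natCast hx2.ne']
    ring_nf
  have e2 : (x ^ 2 / 2) ^ (m - 1) = x ^ (m - 1) * (x / 2) ^ (m - 1) := by
    rw [← Real.mul_rpow hx.le (by positivity)]
    ring_nf
  have e3 : (a * x / 2) ^ (m - 1) = a ^ (m - 1) * (x / 2) ^ (m - 1) := by
    rw [← Real.mul_rpow ha.le (by positivity), mul_div_assoc]
  have e4 : x ^ m = x ^ (m - 1) * x := by
    rw [← Real.rpow_add_one hx.ne', sub_add_cancel]
  have e5 : Real.exp (-(x ^ 2 + a ^ 2) / 2)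
      = Real.exp (-(a ^ 2 / 2)) * Real.exp (-(x ^ 2 / 2)) := by
    rw [← Real.exp_add]
    ring_nf
  have e6 : (a * x / 2) ^ (2 * k) = (a ^ 2 / 2) ^ k * (x ^ 2 / 2) ^ k := by
    rw [pow_mul, ← mul_pow]
    ring_nf
  have ha' : a ^ (m - 1) ≠ 0 := (Real.rpow_pos_of_pos ha _).ne'
  rw [e1, e2, e3, e4, e5, e6, show m - 1 + k + 1 = m + k by ring]
  field_simp

/-- Under `t = x²/2` each term of the Bessel expansion becomes an incomplete gamma integral. The
terms are nonnegative and, since `𝒢 ≤ 1`, their integrals are dominated by Poisson weights, so the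
sum may leave the integral. -/
theorem hasSum_marcumQ {m a b : ℝ} (hm : 0 < m) (ha : 0 < a) (hb : 0 ≤ b) :
    HasSum (fun k : ℕ => Real.exp (-(a ^ 2 / 2)) * (a ^ 2 / 2) ^ k / (k ! : ℝ)
      * regUpperGamma (m + k) (b ^ 2 / 2)) (marcumQ m a b) := by
  set F : ℕ → ℝ → ℝ := fun k x =>
    Real.exp (-(a ^ 2 / 2)) * (a ^ 2 / 2) ^ k / ((k ! : ℝ) * Real.Gamma (m + k))
          * (x * ((x ^ 2 / 2) ^ (m + k - 1) * Real.exp (-(x ^ 2 / 2)))) with hF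
  have hb2 : 0 ≤ b ^ 2 / 2 := by positivity
  have hmk : ∀ k : ℕ, 0 < m + k := fun k => by positivity
  have hs := fun k : ℕ => integrableOn_and_integral_sq_substitution hb
    (integrableOn_upperGamma (hmk k) hb2)
  have hint : ∀ k, IntegrableOn (F k) (Set.Ioi b) := fun k => (hs k).1.const_mul _
  have hval : ∀ k, ∫ x in Set.Ioi b, F k x = Real.exp (-(a ^ 2 / 2)) * (a ^ 2 / 2) ^ k / (k ! : ℝ)
      * regUpperGamma (m + k) (b ^ 2 / 2) := fun k => by
    simp only [hF]
    rw [integral_const_mul, (hs k).2, ← upperGamma, regUpperGamma]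
    have := (Real.Gamma_pos_of_pos (hmk k)).ne'
    field_simp
  have hnorm : ∀ k, ∫ x in Set.Ioi b, ‖F k x‖ = ∫ x in Set.Ioi b, F k x := fun k => by
    refine setIntegral_congr_fun measurableSet_Ioi fun x hx => Real.norm_of_nonneg ?_
    have hx0 : 0 < x := lt_of_le_of_lt hb hx
    have := Real.Gamma_pos_of_pos (hmk k)
    positivity
  have hsum : Summable fun k => ∫ x in Set.Ioi b, ‖F k x‖ := by
    simp only [hnorm, hval]
    refine Summable.of_nonneg_of_le (fun k => ?_) (fun k => ?_)
      ((Real.summable_pow_div_factorial (a ^ 2 / 2)).mul_left (Real.exp (-(a ^ 2 / 2))))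
    · have := (regUpperGamma_pos (hmk k) hb2).le
      positivity
    · rw [mul_div_assoc]
      exact mul_le_of_le_one_right (by positivity) (regUpperGamma_le_one (hmk k) hb2)
  have key := hasSum_integral_of_summable_integral_norm hint hsum
  simp only [hval] at key
  rw [marcumQ, if_neg ha.ne']
  rwa [setIntegral_congr_fun measurableSet_Ioi fun x hx =>
    marcumQ_integrand_eq_tsum ha (lt_of_le_of_lt hb hx)]

theorem hasSum_detectionProb {u lam γ : ℝ} (hu : 0 < u) (hlam : 0 ≤ lam) (hγ : 0 < γ) :
    HasSum (fun k : ℕ => Real.exp (-γ) * γ ^ k / (k ! : ℝ) * regUpperGamma (u + k) (lam / 2))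
      (detectionProb u lam γ) := by
  have h := hasSum_marcumQ hu (Real.sqrt_pos.2 (by positivity : 0 < 2 * γ)) (Real.sqrt_nonneg lam)
  rwa [Real.sq_sqrt (by positivity), Real.sq_sqrt hlam, mul_div_cancel_left₀ _ two_ne_zero] at h

/-! ### Pochhammer symbols and negative binomial sums -/

theorem poch_natCast_add_one_mul_factorial (n l : ℕ) :
    poch ((n : ℝ) + 1) l * (n ! : ℝ) = ((n + l)! : ℝ) := by
  have h := Nat.factorial_mul_ascFactorial n l
  rw [← ascPochhammer_nat_eq_ascFactorial] at h
  have h2 : poch ((n : ℝ) + 1) l = ((ascPochhammer ℕ l).eval (n + 1) : ℕ) := by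
    rw [poch, ascPochhammer_eval_cast]
    push_cast
    rfl
  rw [h2, mul_comm]
  exact_mod_cast h

theorem multichoose_succ_eq_poch_div_factorial (i n : ℕ) :
    ((i + 1).multichoose n : ℝ) = poch (1 + i) n / (n ! : ℝ) := by
  have h := poch_natCast_add_one_mul_factorial i n
  have h2 : ((i + n).choose n : ℝ) * (n ! : ℝ) * (i ! : ℝ) = ((i + n)! : ℝ) := by
    have := Nat.choose_mul_factorial_mul_factorial (Nat.le_add_left n i)
    rw [Nat.add_sub_cancel] at this
    exact_mod_cast this
  rw [Nat.multichoose_eq, show i + 1 + n - 1 = i + n by omega, add_comm (1 : ℝ),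
    eq_div_iff (by positivity)]
  have hi : (i ! : ℝ) ≠ 0 := by positivity
  apply mul_right_cancel₀ hi
  rw [h, h2]

theorem Gamma_add_natCast_add_one {u : ℝ} (hu : 0 < u) (n : ℕ) :
    Real.Gamma (u + n + 1) = poch (1 + u) n * Real.Gamma (u + 1) := by
  induction n with
  | zero => simp [poch]
  | succ n ih =>
    have h0 : u + n + 1 ≠ 0 := by positivity
    rw [poch, ascPochhammer_succ_eval, ← poch]
    push_cast
    rw [← add_assoc, Real.Gamma_add_one h0, ih]
    ring

theorem summable_multichoose_mul_pow (m : ℕ) {q : ℝ} (hq0 : 0 ≤ q) (hq1 : q < 1) :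
    Summable fun n : ℕ => (m.multichoose n : ℝ) * q ^ n := by
  cases m with
  | zero =>
    refine summable_of_ne_finset_zero (s := {0}) fun n hn => ?_
    obtain ⟨k, rfl⟩ := Nat.exists_eq_succ_of_ne_zero (by simpa using hn)
    simp
  | succ i =>
    refine (summable_choose_mul_geometric_of_norm_lt_one i
      (r := q) (by rwa [Real.norm_of_nonneg hq0])).congr fun n => ?_
    rw [Nat.multichoose_eq, show i + 1 + n - 1 = n + i by omega, Nat.choose_symm_add]

theorem summable_mul_multichoose_mul_pow {g : ℕ → ℝ} (hg0 : ∀ n, 0 ≤ g n) (hg1 : ∀ n, g n ≤ 1)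
    (m : ℕ) {q : ℝ} (hq0 : 0 ≤ q) (hq1 : q < 1) :
    Summable fun n : ℕ => g n * ((m.multichoose n : ℝ) * q ^ n) :=
  Summable.of_nonneg_of_le (fun n => mul_nonneg (hg0 n) (by positivity))
    (fun n => mul_le_of_le_one_left (by positivity) (hg1 n))
    (summable_multichoose_mul_pow m hq0 hq1)

/-- Summation by parts, based on Pascal's rule for `multichoose`: multiplication by `1 - q` lowers
the order by one, at the cost of a sum over the increments of `g`. Bounds and monotonicity of `g`
make all three series summable. -/
theorem tsum_mul_multichoose_mul_pow_succ {g : ℕ → ℝ} (hg0 : ∀ n, 0 ≤ g n) (hg1 : ∀ n, g n ≤ 1)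
    (hg : ∀ n, g n ≤ g (n + 1)) (m : ℕ) {q : ℝ} (hq0 : 0 ≤ q) (hq1 : q < 1) :
    (1 - q) * ∑' n : ℕ, g n * (((m + 1).multichoose n : ℝ) * q ^ n)
      = ∑' n : ℕ, g n * ((m.multichoose n : ℝ) * q ^ n)
        + q * ∑' n : ℕ, (g (n + 1) - g n) * (((m + 1).multichoose n : ℝ) * q ^ n) := by
  have s1 := summable_mul_multichoose_mul_pow hg0 hg1 (m + 1) hq0 hq1
  have s0 := summable_mul_multichoose_mul_pow hg0 hg1 m hq0 hq1
  have sd := summable_mul_multichoose_mul_pow (g := fun n => g (n + 1) - g n)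
    (fun n => sub_nonneg.2 (hg n)) (fun n => by linarith [hg0 n, hg1 (n + 1)]) (m + 1) hq0 hq1
  have e : ∑' n : ℕ, g (n + 1) * (((m + 1).multichoose (n + 1) : ℝ) * q ^ (n + 1))
      = ∑' n : ℕ, g (n + 1) * ((m.multichoose (n + 1) : ℝ) * q ^ (n + 1))
        + q * (∑' n : ℕ, g n * (((m + 1).multichoose n : ℝ) * q ^ n)
          + ∑' n : ℕ, (g (n + 1) - g n) * (((m + 1).multichoose n : ℝ) * q ^ n)) := by
    rw [← s1.tsum_add sd, ← tsum_mul_left, ← ((summable_nat_add_iff 1).2 s0).tsum_add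
      ((s1.add sd).mul_left q)]
    congr 1
    funext n
    rw [Nat.multichoose_succ_succ]
    push_cast
    ring
  have h1 := s1.tsum_eq_zero_add
  have h0 := s0.tsum_eq_zero_add
  rw [e] at h1
  simp only [Nat.multichoose_zero_right] at h1 h0
  linarith

/-- Iterating the previous identity down to order zero, where only the term `n = 0` survives and
contributes `g 0`. -/
theorem tsum_mul_multichoose_mul_pow {g : ℕ → ℝ} (hg0 : ∀ n, 0 ≤ g n) (hg1 : ∀ n, g n ≤ 1)
    (hg : ∀ n, g n ≤ g (n + 1)) (m : ℕ) {q : ℝ} (hq0 : 0 ≤ q) (hq1 : q < 1) :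
    (1 - q) ^ m * ∑' n : ℕ, g n * ((m.multichoose n : ℝ) * q ^ n)
      = g 0 + ∑ i ∈ Finset.range m, (1 - q) ^ i *
        (q * ∑' n : ℕ, (g (n + 1) - g n) * (((i + 1).multichoose n : ℝ) * q ^ n)) := by
  induction m with
  | zero =>
    rw [tsum_eq_single 0]
    · simp
    · intro n hn
      obtain ⟨k, rfl⟩ := Nat.exists_eq_succ_of_ne_zero hn
      simp
  | succ m ih =>
    rw [pow_succ, mul_assoc, tsum_mul_multichoose_mul_pow_succ hg0 hg1 hg m hq0 hq1, mul_add, ih,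
      Finset.sum_range_succ, add_assoc]

/-! ### Averaging over a gamma distribution -/

/-- The mean of `detectionProb u (2 * x)` over a gamma distribution of shape `m` and rate `p`,
in closed form. -/
def gammaAvgDetectionProb (u x p : ℝ) (m : ℕ) : ℝ :=
  regUpperGamma u x + x ^ u * Real.exp (-x) / Real.Gamma (u + 1) *
    ∑ i ∈ Finset.range m, p ^ i / (1 + p) ^ (i + 1) * kummer1F1 (1 + i) (1 + u) (x / (1 + p))

/-- The increments of `𝒢(u+n, x)` in `n` are `x^(u+n) e^(-x) / Γ(u+n+1)`. Against the weights of
order `i+1` with `q = 1/(1+p)` they sum to a Kummer series at `x/(1+p)`. -/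
theorem tsum_regUpperGamma_mul_multichoose {u x p : ℝ} (hu : 0 < u) (hx : 0 < x) (hp : 0 < p)
    (m : ℕ) :
    ∑' n : ℕ, regUpperGamma (u + n) x * ((m.multichoose n : ℝ) * (1 / (1 + p)) ^ n)
      = ((1 + p) / p) ^ m * gammaAvgDetectionProb u x p m := by
  have hstep : ∀ n : ℕ, regUpperGamma (u + (n + 1 : ℕ)) x - regUpperGamma (u + n) x
      = x ^ (u + n) * Real.exp (-x) / Real.Gamma (u + n + 1) := fun n => by
    push_cast
    rw [← add_assoc, regUpperGamma_add_one (by positivity) hx]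
    ring
  have hpos : ∀ n : ℕ, 0 ≤ x ^ (u + n) * Real.exp (-x) / Real.Gamma (u + n + 1) := fun n => by
    have := Real.Gamma_pos_of_pos (show 0 < u + n + 1 by positivity)
    positivity
  have key := tsum_mul_multichoose_mul_pow (g := fun n : ℕ => regUpperGamma (u + n) x)
    (fun n => (regUpperGamma_pos (by positivity) hx.le).le)
    (fun n => regUpperGamma_le_one (by positivity) hx.le)
    (fun n => sub_nonneg.1 ((hpos n).trans_eq (hstep n).symm)) m (q := 1 / (1 + p))
    (by positivity) (by rw [div_lt_one (by positivity)]; linarith)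
  have hq : 1 - 1 / (1 + p) = p / (1 + p) := by field_simp; ring
  have hk : ∀ i : ℕ, ∑' n : ℕ, (regUpperGamma (u + (n + 1 : ℕ)) x - regUpperGamma (u + n) x)
      * (((i + 1).multichoose n : ℝ) * (1 / (1 + p)) ^ n)
      = x ^ u * Real.exp (-x) / Real.Gamma (u + 1)
        * kummer1F1 (1 + i) (1 + u) (x / (1 + p)) := fun i => by
    rw [kummer1F1, ← tsum_mul_left]
    congr 1
    funext n
    rw [hstep, Gamma_add_natCast_add_one hu, multichoose_succ_eq_poch_div_factorial,
      Real.rpow_add_natCast hx.ne', div_pow, div_pow, one_pow]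
    ring
  rw [hq] at key
  simp only [hk] at key
  have h1 : ((1 + p) / p) ^ m * (p / (1 + p)) ^ m = 1 := by
    rw [← mul_pow, div_mul_div_cancel₀ hp.ne', div_self (by positivity), one_pow]
  apply mul_left_cancel₀ (show (p / (1 + p)) ^ m ≠ 0 by positivity)
  rw [key, ← mul_assoc, mul_comm ((p / (1 + p)) ^ m), h1, one_mul, gammaAvgDetectionProb,
    Finset.mul_sum]
  congr 1
  · simp
  · refine Finset.sum_congr rfl fun i _ => ?_
    rw [div_pow, pow_succ]
    field_simp

theorem integrableOn_pow_mul_exp_neg_mul {r : ℝ} (hr : 0 < r) (n : ℕ) :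
    IntegrableOn (fun t : ℝ => t ^ n * Real.exp (-(r * t))) (Set.Ioi 0) := by
  have h := integrableOn_rpow_mul_exp_neg_mul_rpow (s := n) (p := 1) (b := r)
    (by linarith [(Nat.cast_nonneg n : (0 : ℝ) ≤ n)]) zero_lt_one hr
  simpa using h

theorem integral_pow_mul_exp_neg_mul {r : ℝ} (hr : 0 < r) (n : ℕ) :
    ∫ t in Set.Ioi (0 : ℝ), t ^ n * Real.exp (-(r * t)) = (n ! : ℝ) / r ^ (n + 1) := by
  have h := Real.integral_rpow_mul_exp_neg_mul_Ioi (a := (n : ℝ) + 1) (by positivity) hr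
  simp only [add_sub_cancel_right, Real.rpow_natCast] at h
  rw [h, Real.Gamma_nat_eq_factorial]
  have : (1 / r) ^ ((n : ℝ) + 1) = 1 / r ^ (n + 1) := by
    rw [← Nat.cast_succ, Real.rpow_natCast, one_div_pow]
  rw [this]
  ring

/-- Integrating the Poisson mixture term by term yields `(n+m)!/(1+p)^(n+m+1)`. Dividing by `n!`
leaves `m!` times the negative binomial coefficient of order `m+1`. -/
theorem integral_detectionProb_mul_pow_mul_exp {u lam p : ℝ} (hu : 0 < u) (hlam : 0 < lam)
    (hp : 0 < p) (m : ℕ) :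
    ∫ γ in Set.Ioi (0 : ℝ), detectionProb u lam γ * (γ ^ m * Real.exp (-(p * γ)))
      = (m ! : ℝ) / p ^ (m + 1) * gammaAvgDetectionProb u (lam / 2) p (m + 1) := by
  set F : ℕ → ℝ → ℝ := fun n γ =>
    regUpperGamma (u + n) (lam / 2) / (n ! : ℝ) * (γ ^ (n + m) * Real.exp (-((1 + p) * γ))) with hF
  have hr : 0 < 1 + p := by positivity
  have hx : 0 < lam / 2 := by positivity
  have hG0 : ∀ n : ℕ, 0 ≤ regUpperGamma (u + n) (lam / 2) := fun n =>
    (regUpperGamma_pos (by positivity) hx.le).le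
  have hint : ∀ n, IntegrableOn (F n) (Set.Ioi 0) := fun n =>
    (integrableOn_pow_mul_exp_neg_mul hr (n + m)).const_mul _
  have hval : ∀ n, ∫ γ in Set.Ioi (0 : ℝ), F n γ = (m ! : ℝ) / (1 + p) ^ (m + 1) *
      (regUpperGamma (u + n) (lam / 2) * (((m + 1).multichoose n : ℝ) * (1 / (1 + p)) ^ n)) := by
    intro n
    have hc : ((m + 1).multichoose n : ℝ) * (n ! : ℝ) * (m ! : ℝ) = ((n + m)! : ℝ) := by
      rw [multichoose_succ_eq_poch_div_factorial, div_mul_cancel₀ _ (by positivity),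
        add_comm (1 : ℝ), poch_natCast_add_one_mul_factorial, add_comm m]
    simp only [hF]
    rw [integral_const_mul, integral_pow_mul_exp_neg_mul hr, ← hc, one_div_pow, add_assoc, pow_add]
    field_simp
  have hnorm : ∀ n, ∫ γ in Set.Ioi (0 : ℝ), ‖F n γ‖ = ∫ γ in Set.Ioi (0 : ℝ), F n γ := fun n => by
    refine setIntegral_congr_fun measurableSet_Ioi fun γ hγ => Real.norm_of_nonneg ?_
    have hγ0 : 0 < γ := hγ
    have := hG0 n
    positivity
  have hsum : Summable fun n => ∫ γ in Set.Ioi (0 : ℝ), ‖F n γ‖ := by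
    simp only [hnorm, hval]
    exact (summable_mul_multichoose_mul_pow hG0
      (fun n => regUpperGamma_le_one (by positivity) hx.le) (m + 1) (by positivity)
      (by rw [div_lt_one hr]; linarith)).mul_left _
  have key := (hasSum_integral_of_summable_integral_norm hint hsum).tsum_eq
  simp only [hval] at key
  rw [tsum_mul_left, tsum_regUpperGamma_mul_multichoose hu hx hp] at key
  have hpt : ∀ γ ∈ Set.Ioi (0 : ℝ), detectionProb u lam γ * (γ ^ m * Real.exp (-(p * γ)))
      = ∑' n, F n γ := fun γ hγ => by
    rw [← (hasSum_detectionProb hu hlam.le hγ).tsum_eq, ← tsum_mul_right]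
    congr 1
    funext n
    simp only [hF]
    rw [show -((1 + p) * γ) = -γ + -(p * γ) by ring, Real.exp_add, pow_add]
    ring
  rw [setIntegral_congr_fun measurableSet_Ioi hpt, ← key, div_pow]
  field_simp

theorem kummer1F1_nonneg {a b z : ℝ} (ha : 0 < a) (hb : 0 < b) (hz : 0 ≤ z) :
    0 ≤ kummer1F1 a b z := by
  refine tsum_nonneg fun n => ?_
  have h1 : 0 < poch a n := ascPochhammer_pos n a ha
  have h2 : 0 < poch b n := ascPochhammer_pos n b hb
  positivity

theorem gammaAvgDetectionProb_pos {u x p : ℝ} (hu : 0 < u) (hx : 0 < x) (hp : 0 < p) (m : ℕ) :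
    0 < gammaAvgDetectionProb u x p m := by
  refine add_pos_of_pos_of_nonneg (regUpperGamma_pos hu hx.le) (mul_nonneg ?_ ?_)
  · have := Real.Gamma_pos_of_pos (show 0 < u + 1 by positivity)
    positivity
  · refine Finset.sum_nonneg fun i _ => mul_nonneg (by positivity) ?_
    exact kummer1F1_nonneg (by positivity) (by positivity) (by positivity)

/-- The Bochner integral of a non-integrable function is zero by convention, so the positive value
already computed forces integrability. -/
theorem integrableOn_detectionProb_mul_pow_mul_exp {u lam p : ℝ} (hu : 0 < u) (hlam : 0 < lam)
    (hp : 0 < p) (m : ℕ) :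
    IntegrableOn (fun γ => detectionProb u lam γ * (γ ^ m * Real.exp (-(p * γ))))
      (Set.Ioi 0) := by
  refine Integrable.of_integral_ne_zero ?_
  rw [integral_detectionProb_mul_pow_mul_exp hu hlam hp]
  have := gammaAvgDetectionProb_pos hu (half_pos hlam) hp (m + 1)
  positivity

/-! ### The η-μ density as a combination of gamma-type functions -/

theorem EtaMuFormat.h_sub_H_pos_and_h_add_H_pos {fmt : EtaMuFormat} {η : ℝ} (hη : fmt.Admissible η) :
    0 < fmt.h η - fmt.H η ∧ 0 < fmt.h η + fmt.H η := by
  cases fmt with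
  | format1 =>
    have h0 : 0 < η := hη
    have : 0 < η⁻¹ := inv_pos.2 h0
    constructor <;> simp only [EtaMuFormat.h, EtaMuFormat.H] <;> linarith
  | format2 =>
    obtain ⟨h1, h2⟩ : -1 < η ∧ η < 1 := hη
    have h3 : 0 < 1 - η ^ 2 := by nlinarith
    constructor <;> simp only [EtaMuFormat.h, EtaMuFormat.H]
    · rw [← sub_div]
      exact div_pos (by linarith) h3
    · rw [← add_div]
      exact div_pos (by linarith) h3

theorem rpow_natCast_add_half {x : ℝ} (hx : 0 < x) (n : ℕ) :
    x ^ ((n : ℝ) + 1 / 2) = x ^ n * √x := by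
  rw [Real.rpow_add hx, Real.rpow_natCast, ← Real.sqrt_eq_rpow]

/-- The power `|H|^(μ-1/2)` in the denominator cancels the one inside the Bessel function. What
remains is the entire factor, even in its argument, so the sign of `H` no longer matters and only
integer powers are left. -/
theorem etaMuPDF_eq_besselISeries {h H γbar γ : ℝ} (n : ℕ) (hH : H ≠ 0) (hγbar : 0 < γbar)
    (hγ : 0 < γ) :
    etaMuPDF h H ((n + 1 : ℕ) : ℝ) γbar γ =
      2 * √Real.pi * h ^ (n + 1) / (n ! : ℝ) * (((n + 1 : ℕ) : ℝ) / γbar) ^ (2 * n + 2)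
        * γ ^ (2 * n + 1) * Real.exp (-(2 * h * (((n + 1 : ℕ) : ℝ) * γ / γbar)))
        * besselISeries ((n : ℝ) + 1 / 2) (2 * (((n + 1 : ℕ) : ℝ) * γ / γbar) * H) := by
  have hμ : (0 : ℝ) < ((n + 1 : ℕ) : ℝ) := by positivity
  rw [etaMuPDF, etaMuPDFC_eq hH hμ hγbar hγ, Complex.ofReal_re, besselI]
  have e0 : ((n + 1 : ℕ) : ℝ) - 1 / 2 = (n : ℝ) + 1 / 2 := by push_cast; ring
  have eΓ : Real.Gamma ((n + 1 : ℕ) : ℝ) = (n ! : ℝ) := by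
    rw [Nat.cast_succ, Real.Gamma_nat_eq_factorial]
  rw [e0, eΓ, Real.rpow_natCast, rpow_natCast_add_half hμ, rpow_natCast_add_half hγbar,
    rpow_natCast_add_half hγ]
  generalize ((n + 1 : ℕ) : ℝ) = μ at hμ
  have hH' : 0 < |H| := abs_pos.2 hH
  have e1 : 2 * μ * |H| * γ / γbar / 2 = μ * γ / γbar * |H| := by ring
  have e2 : besselISeries ((n : ℝ) + 1 / 2) (2 * μ * |H| * γ / γbar)
      = besselISeries ((n : ℝ) + 1 / 2) (2 * (μ * γ / γbar) * H) := by
    rw [← besselISeries_abs _ (2 * (μ * γ / γbar) * H), abs_mul,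
      abs_of_pos (show 0 < 2 * (μ * γ / γbar) by positivity)]
    ring_nf
  have e3 : (μ * γ / γbar * |H|) ^ ((n : ℝ) + 1 / 2)
      = (μ * γ / γbar) ^ n * (√μ * √γ / √γbar) * |H| ^ ((n : ℝ) + 1 / 2) := by
    rw [Real.mul_rpow (by positivity) hH'.le, rpow_natCast_add_half (by positivity),
      Real.sqrt_div (by positivity), Real.sqrt_mul hμ.le]
  have e4 : Real.exp (-2 * μ * h * γ / γbar) = Real.exp (-(2 * h * (μ * γ / γbar))) := by
    ring_nf
  rw [e1, e2, e3, e4]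
  have hHν : |H| ^ ((n : ℝ) + 1 / 2) ≠ 0 := (Real.rpow_pos_of_pos hH' _).ne'
  generalize |H| ^ ((n : ℝ) + 1 / 2) = X at hHν
  generalize Real.exp (-(2 * h * (μ * γ / γbar))) = E
  generalize besselISeries ((n : ℝ) + 1 / 2) (2 * (μ * γ / γbar) * H) = S
  -- Writing `μ`, `γ`, `γbar` as squares of their roots turns the goal into a rational identity.
  have s1 := Real.sq_sqrt hμ.le
  have s2 := Real.sq_sqrt hγ.le
  have s3 := Real.sq_sqrt hγbar.le
  have p1 := Real.sqrt_pos.2 hμ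
  have p2 := Real.sqrt_pos.2 hγ
  have p3 := Real.sqrt_pos.2 hγbar
  generalize √μ = a at *
  generalize √γ = b at *
  generalize √γbar = c at *
  subst s1 s2 s3
  simp only [div_pow]
  field_simp
  ring

/-- The exponentials `e^(±2μHγ/γbar)` of the half-integer Bessel function merge with
`e^(-2μhγ/γbar)`, giving the rates with `h - H` and `h + H`. The sign `(-1)^l` comes from evaluating
`besselPoly` at a negated argument. -/
theorem etaMuPDF_eq_sum {h H γbar γ : ℝ} (n : ℕ) (hH : H ≠ 0) (hγbar : 0 < γbar)
    (hγ : 0 < γ) :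
    etaMuPDF h H ((n + 1 : ℕ) : ℝ) γbar γ =
      ∑ l ∈ Finset.range (n + 1),
        poch ((n + 1 : ℕ) : ℝ) l * h ^ (n + 1) / ((l ! : ℝ) * ((n - l)! : ℝ) * 4 ^ l * H ^ (n + 1 + l))
          * (((n + 1 : ℕ) : ℝ) / γbar) ^ (n - l + 1)
          * ((-1) ^ l * (γ ^ (n - l)
                * Real.exp (-(2 * ((n + 1 : ℕ) : ℝ) * (h - H) / γbar * γ)))
            + (-1) ^ (n + 1) * (γ ^ (n - l)
                * Real.exp (-(2 * ((n + 1 : ℕ) : ℝ) * (h + H) / γbar * γ)))) := by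
  have hμ : (0 : ℝ) < ((n + 1 : ℕ) : ℝ) := by positivity
  have hz : 2 * (((n + 1 : ℕ) : ℝ) * γ / γbar) * H ≠ 0 := by positivity
  have hpoch : ∀ l, poch ((n + 1 : ℕ) : ℝ) l = ((n + l)! : ℝ) / (n ! : ℝ) := fun l => by
    rw [eq_div_iff (by positivity), Nat.cast_succ, poch_natCast_add_one_mul_factorial]
  have hcoef : ∀ l ∈ Finset.range (n + 1),
      ((n + l).choose (2 * l) : ℝ) * ((2 * l)! / l ! : ℝ)
        = ((n + l)! : ℝ) / ((l ! : ℝ) * ((n - l)! : ℝ)) := fun l hl => by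
    have hl' : l ≤ n := Nat.lt_succ_iff.1 (Finset.mem_range.1 hl)
    have := Nat.choose_mul_factorial_mul_factorial (show 2 * l ≤ n + l by omega)
    rw [show n + l - 2 * l = n - l by omega] at this
    rw [← this]
    push_cast
    field_simp
  rw [etaMuPDF_eq_besselISeries n hH hγbar hγ, besselISeries_nat_add_half hz]
  simp only [hpoch]
  unfold besselPoly
  generalize ((n + 1 : ℕ) : ℝ) = μ at *
  rw [Finset.mul_sum, Finset.mul_sum, ← Finset.sum_add_distrib, Finset.mul_sum, Finset.mul_sum]
  refine Finset.sum_congr rfl fun l hl => ?_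
  rw [hcoef l hl]
  obtain ⟨d, rfl⟩ := Nat.exists_eq_add_of_le (Nat.lt_succ_iff.1 (Finset.mem_range.1 hl))
  rw [Nat.add_sub_cancel_left]
  have e1 : Real.exp (-(2 * μ * (h - H) / γbar * γ))
      = Real.exp (-(2 * h * (μ * γ / γbar))) * Real.exp (2 * (μ * γ / γbar) * H) := by
    rw [← Real.exp_add]
    ring_nf
  have e2 : Real.exp (-(2 * μ * (h + H) / γbar * γ))
      = Real.exp (-(2 * h * (μ * γ / γbar))) * Real.exp (-(2 * (μ * γ / γbar) * H)) := by
    rw [← Real.exp_add]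
    ring_nf
  rw [e1, e2]
  have hpi : √Real.pi ≠ 0 := by positivity
  generalize Real.exp (-(2 * h * (μ * γ / γbar))) = E
  generalize Real.exp (2 * (μ * γ / γbar) * H) = E1
  generalize Real.exp (-(2 * (μ * γ / γbar) * H)) = E2
  have h4 : (4 : ℝ) ^ l = 2 ^ l * 2 ^ l := by rw [← mul_pow]; norm_num
  rw [← neg_div, h4]
  simp only [div_pow, one_pow, mul_pow]
  field_simp
  ring

/-! ### Matching coefficients and assembling the formula -/

/-- Bookkeeping for one gamma component, to be used with `a = h ∓ H` and `d = μ-1-l`; `K` collects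
the factors common to both components. The main rewriting is `1 + p = (γbar + 2aμ)/γbar` for `p =
2μa/γbar`. -/
theorem gammaAvgDetectionProb_mul_coeff {u lam γbar μ a : ℝ} (hu : 0 < u) (hlam : 0 < lam)
    (hγbar : 0 < γbar) (hμ : 0 < μ) (ha : 0 < a) (K : ℝ) (l d : ℕ) :
    K / ((d ! : ℝ) * 4 ^ l) * (μ / γbar) ^ (d + 1) * ((d ! : ℝ) / (2 * μ * a / γbar) ^ (d + 1)
        * gammaAvgDetectionProb u (lam / 2) (2 * μ * a / γbar) (d + 1))
      = K * regUpperGamma u (lam / 2) / 2 ^ (l + d + 1 + l) / a ^ (d + 1)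
        + ∑ i ∈ Finset.range (d + 1), K * μ ^ i * lam ^ u * γbar * Real.exp (-lam / 2)
            / (Real.Gamma (u + 1) * (2 : ℝ) ^ (((l + d + 1 : ℕ) : ℝ) + u + (l : ℝ) - (i : ℝ)))
          * (kummer1F1 (1 + i) (1 + u) (lam * γbar / (2 * γbar + 4 * μ * a))
            / (a ^ (d + 1 - i) * (γbar + 2 * a * μ) ^ (i + 1))) := by
  have hΓ := (Real.Gamma_pos_of_pos (show 0 < u + 1 by positivity)).ne'
  have hC : K / ((d ! : ℝ) * 4 ^ l) * (μ / γbar) ^ (d + 1)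
      * ((d ! : ℝ) / (2 * μ * a / γbar) ^ (d + 1)) = K / 2 ^ (l + d + 1 + l) / a ^ (d + 1) := by
    have h4 : (4 : ℝ) ^ l = 2 ^ l * 2 ^ l := by rw [← mul_pow]; norm_num
    rw [h4]
    simp only [div_pow]
    field_simp
    ring
  rw [← mul_assoc, hC, gammaAvgDetectionProb, mul_add, Finset.mul_sum, Finset.mul_sum]
  congr 1
  · ring
  · refine Finset.sum_congr rfl fun i hi => ?_
    obtain ⟨j, rfl⟩ := Nat.exists_eq_add_of_le (Nat.lt_succ_iff.1 (Finset.mem_range.1 hi))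
    have e1 : (2 : ℝ) ^ (((l + (i + j) + 1 : ℕ) : ℝ) + u + (l : ℝ) - (i : ℝ))
        = 2 ^ u * 2 ^ (l + (i + j) + 1 + l) / 2 ^ i := by
      rw [Real.rpow_sub two_pos, Real.rpow_add two_pos, Real.rpow_add two_pos]
      simp only [Real.rpow_natCast]
      ring
    have e2 : lam / 2 / (1 + 2 * μ * a / γbar) = lam * γbar / (2 * γbar + 4 * μ * a) := by
      field_simp
      ring
    have e3 : 1 + 2 * μ * a / γbar = (γbar + 2 * a * μ) / γbar := by
      field_simp
    have e4 : a ^ (i + j + 1) = a ^ (i + j + 1 - i) * a ^ i := by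
      rw [← pow_add]
      congr 1
      omega
    have h2u : (2 : ℝ) ^ u ≠ 0 := by positivity
    rw [e1, e2, e3, e4, Real.div_rpow hlam.le zero_le_two, neg_div, div_pow, div_pow]
    generalize kummer1F1 _ _ _ = F
    generalize a ^ (i + j + 1 - i) = A
    field_simp
    ring

end

theorem corollary1 (fmt : EtaMuFormat) (η h H u γbar lam : ℝ) (μ : ℕ)
    (hη : fmt.Admissible η) (hh : h = fmt.h η) (hH : H = fmt.H η) (hH0 : H ≠ 0)
    (hu : 0 < u) (hγbar : 0 < γbar) (hlam : 0 < lam) (hμ : 0 < μ) :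
    MeasureTheory.IntegrableOn
        (fun γ : ℝ => detectionProb u lam γ * etaMuPDF h H (μ : ℝ) γbar γ) (Set.Ioi 0) ∧
      avgDetectionProb h H (μ : ℝ) γbar u lam =
        (∑ l ∈ Finset.range μ,
          poch (μ : ℝ) l * h ^ μ * regUpperGamma u (lam / 2)
              / ((l ! : ℝ) * 2 ^ (μ + l) * H ^ (μ + l))
            * ((-1) ^ l / (h - H) ^ (μ - l) + (-1) ^ μ / (h + H) ^ (μ - l)))
        + ∑ l ∈ Finset.range μ, ∑ i ∈ Finset.range (μ - l),
          h ^ μ * (μ : ℝ) ^ i * lam ^ u * poch (μ : ℝ) l * γbar * Real.exp (-lam / 2)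
              / (Real.Gamma (u + 1) * (l ! : ℝ)
                  * (2 : ℝ) ^ ((μ : ℝ) + u + (l : ℝ) - (i : ℝ)) * H ^ (μ + l))
            * ((-1) ^ l
                  * kummer1F1 (1 + i) (1 + u)
                      (lam * γbar / (2 * γbar + 4 * (μ : ℝ) * (h - H)))
                  / ((h - H) ^ (μ - l - i) * (γbar + 2 * (h - H) * (μ : ℝ)) ^ (i + 1))
              + (-1) ^ μ
                  * kummer1F1 (1 + i) (1 + u)
                      (lam * γbar / (2 * γbar + 4 * (μ : ℝ) * (h + H)))
                  / ((h + H) ^ (μ - l - i) * (γbar + 2 * (h + H) * (μ : ℝ)) ^ (i + 1))) := by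
  -- With `μ = n + 1` the Bessel order `μ - 1/2` is `n + 1/2`.
  obtain ⟨n, rfl⟩ : ∃ n, μ = n + 1 := ⟨μ - 1, by omega⟩
  have hpm : 0 < h - H ∧ 0 < h + H := by
    rw [hh, hH]
    exact EtaMuFormat.h_sub_H_pos_and_h_add_H_pos hη
  obtain ⟨hm, hp⟩ := hpm
  have hμ' : (0 : ℝ) < ((n + 1 : ℕ) : ℝ) := by positivity
  set c : ℕ → ℝ := fun l =>
    poch ((n + 1 : ℕ) : ℝ) l * h ^ (n + 1) / ((l ! : ℝ) * H ^ (n + 1 + l)) with hc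
  set w : ℕ → ℝ := fun l =>
    c l / (((n - l)! : ℝ) * 4 ^ l) * (((n + 1 : ℕ) : ℝ) / γbar) ^ (n - l + 1) with hw
  set f : ℝ → ℕ → ℝ → ℝ := fun a l γ => detectionProb u lam γ * (γ ^ (n - l)
    * Real.exp (-(2 * ((n + 1 : ℕ) : ℝ) * a / γbar * γ))) with hf
  have hfint : ∀ a, 0 < a → ∀ l, IntegrableOn (f a l) (Set.Ioi 0) := fun a ha l =>
    integrableOn_detectionProb_mul_pow_mul_exp hu hlam (by positivity) _
  have hg : ∀ l, IntegrableOn (fun γ => w l * ((-1) ^ l * f (h - H) l γ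
      + (-1) ^ (n + 1) * f (h + H) l γ)) (Set.Ioi 0) := fun l =>
    (((hfint _ hm l).const_mul _).add ((hfint _ hp l).const_mul _)).const_mul _
  -- The expansion of the density holds only for `γ > 0`, which suffices for integrals over `Ioi 0`.
  have hpt : Set.EqOn (fun γ => ∑ l ∈ Finset.range (n + 1), w l * ((-1) ^ l * f (h - H) l γ
      + (-1) ^ (n + 1) * f (h + H) l γ))
      (fun γ => detectionProb u lam γ * etaMuPDF h H ((n + 1 : ℕ) : ℝ) γbar γ) (Set.Ioi 0) := by
    intro γ hγ
    simp only [etaMuPDF_eq_sum n hH0 hγbar hγ, Finset.mul_sum, hw, hc, hf]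
    refine Finset.sum_congr rfl fun l _ => ?_
    field_simp
  refine ⟨IntegrableOn.congr_fun (integrable_finsetSum _ fun l _ => hg l) hpt measurableSet_Ioi, ?_⟩
  rw [avgDetectionProb, ← setIntegral_congr_fun measurableSet_Ioi hpt,
    integral_finsetSum _ fun l _ => hg l, ← Finset.sum_add_distrib]
  refine Finset.sum_congr rfl fun l hl => ?_
  rw [integral_const_mul, integral_add ((hfint _ hm l).const_mul _) ((hfint _ hp l).const_mul _),
    integral_const_mul, integral_const_mul,
    integral_detectionProb_mul_pow_mul_exp hu hlam (by positivity),
    integral_detectionProb_mul_pow_mul_exp hu hlam (by positivity)]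
  obtain ⟨d, rfl⟩ := Nat.exists_eq_add_of_le (Nat.lt_succ_iff.1 (Finset.mem_range.1 hl))
  have hd : l + d + 1 - l = d + 1 := by omega
  have hm' := gammaAvgDetectionProb_mul_coeff hu hlam hγbar hμ' hm (c l) l d
  have hp' := gammaAvgDetectionProb_mul_coeff hu hlam hγbar hμ' hp (c l) l d
  simp only [hw, Nat.add_sub_cancel_left, hd]
  rw [mul_add, mul_left_comm, hm', mul_left_comm _ ((-1) ^ (l + d + 1)), hp', mul_add, mul_add,
    add_add_add_comm, Finset.mul_sum, Finset.mul_sum, ← Finset.sum_add_distrib]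
  congr 1
  · simp only [hc]
    field_simp
  · refine Finset.sum_congr rfl fun i _ => ?_
    simp only [hc]
    -- Both sides carry the same real power of `2`, so it can be treated as an opaque factor.
    generalize (2 : ℝ) ^ (_ : ℝ) = T
    field_simp
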